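/- Let $F$ be an algebraically closed field of characteristic $0$ and let $n\ge 5$. Let $M_n=M_n(F)$, let $\mathfrak{gl}(n^2)=\mathrm{End}_F(M_n)$ be the space of all $F$-linear operators on $M_n$, and let $\mathfrak g=\{x\mapsto ax-xa \mid a\in M_n\}\subseteq \mathfrak{gl}(n^2)$ be the set of all inner derivations of $M_n$. Write $M_n^0=\{a\in M_n\mid \operatorname{tr}(a)=0\}$, so that $M_n=M_n^0\oplus F1$. Let $\mathfrak{gl}(n^2-1)$ be the set of all $f\in\mathfrak{gl}(n^2)$ with $f(M_n^0)\subseteq M_n^0$, $f(F1)\subseteq F1$ and $f(1)=0$. Let $\mathfrak p=\{x\mapsto \operatorname{tr}(x)a\mid a\in M_n^0\}$ and $\mathfrak q=\{x\mapsto \operatorname{tr}(xa)1\mid a\in M_n^0\}$. Let $T$ be the group of all operators $t\in\mathfrak{gl}(n^2)$ for which there are nonzero $\alpha,\beta\in F$ such that $t$ acts as multiplication by $\alpha$ on $M_n^0$ and as multiplication by $\beta$ on $F1$. A linear subspace $A$ of $\mathfrak{gl}(n^2)$ is a proper associative (not necessarily unital) subalgebra of $\mathfrak{gl}(n^2)$,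 under composition, that contains $\mathfrak g$ if and only if $A$ is one of $$\mathfrak{gl}(n^2-1),\quad \mathfrak{gl}(n^2-1)+\mathfrak p,\quad \mathfrak{gl}(n^2-1)+\mathfrak q,$$ $$\mathfrak{gl}(n^2-1)+Ft,\quad \mathfrak{gl}(n^2-1)+\mathfrak p+Ft,\quad \mathfrak{gl}(n^2-1)+\mathfrak q+Ft$$ for some $t\in T$. Moreover, there are exactly six such subalgebras $A$. -/

import Mathlib

namespace InnerDerivations

/-- The space `M_n` of `n × n` matrices over `F`. -/
abbrev Mat (F : Type*) (n : ℕ) : Type _ := Matrix (Fin n) (Fin n) F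

/-- The algebra `gl(n²)` of all linear operators on the space `M_n`
(with composition as associative product). -/
abbrev Gl (F : Type*) [Field F] (n : ℕ) : Type _ := Module.End F (Mat F n)

/-- The space `M_n⁰` of matrices of trace zero. -/
def traceZero (F : Type*) [Field F] (n : ℕ) : Submodule F (Mat F n) :=
  LinearMap.ker (Matrix.traceLinearMap (Fin n) F F)

/-- The line `F1` of scalar matrices. -/
def scalars (F : Type*) [Field F] (n : ℕ) : Submodule F (Mat F n) :=
  Submodule.span F {1}

/-- The space `g` of all inner derivations `x ↦ ax - xa` of `M_n`. -/
def innerDer (F : Type*) [Field F] (n : ℕ) : Submodule F (Gl F n) :=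
  LinearMap.range (LinearMap.mul F (Mat F n) - (LinearMap.mul F (Mat F n)).flip)

/-- `gl(n² - 1)`: the operators that preserve the decomposition `M_n = M_n⁰ + F1`
and send `1` to `0`. -/
def glSub (F : Type*) [Field F] (n : ℕ) : Submodule F (Gl F n) where
  carrier := {f | (∀ x ∈ traceZero F n, f x ∈ traceZero F n) ∧
    (∀ x ∈ scalars F n, f x ∈ scalars F n) ∧ f 1 = 0}
  add_mem' := fun {f g} hf hg =>
    ⟨fun x hx => add_mem (hf.1 x hx) (hg.1 x hx),
      fun x hx => add_mem (hf.2.1 x hx) (hg.2.1 x hx),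
      by rw [LinearMap.add_apply, hf.2.2, hg.2.2, add_zero]⟩
  zero_mem' := ⟨fun _ _ => zero_mem _, fun _ _ => zero_mem _, rfl⟩
  smul_mem' := fun c f hf =>
    ⟨fun x hx => Submodule.smul_mem _ c (hf.1 x hx),
      fun x hx => Submodule.smul_mem _ c (hf.2.1 x hx),
      by rw [LinearMap.smul_apply, hf.2.2, smul_zero]⟩

/-- The linear map taking `a` to the operator `x ↦ tr(x) a`. -/
def pMap (F : Type*) [Field F] (n : ℕ) : Mat F n →ₗ[F] Gl F n :=
  LinearMap.smulRightₗ (Matrix.traceLinearMap (Fin n) F F)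

/-- The linear map taking `a` to the operator `x ↦ tr(x a) 1`. -/
def qMap (F : Type*) [Field F] (n : ℕ) : Mat F n →ₗ[F] Gl F n :=
  LinearMap.mk₂ F (fun a x => (x * a).trace • (1 : Mat F n))
    (fun a b x => by rw [mul_add, Matrix.trace_add, add_smul])
    (fun c a x => by rw [Matrix.mul_smul, Matrix.trace_smul, smul_assoc])
    (fun a x y => by rw [add_mul, Matrix.trace_add, add_smul])
    (fun c a x => by rw [Matrix.smul_mul, Matrix.trace_smul, smul_assoc])

/-- The space `p` of all operators `x ↦ tr(x) a` with `a ∈ M_n⁰`. -/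
def pSpace (F : Type*) [Field F] (n : ℕ) : Submodule F (Gl F n) :=
  (traceZero F n).map (pMap F n)

/-- The space `q` of all operators `x ↦ tr(x a) 1` with `a ∈ M_n⁰`. -/
def qSpace (F : Type*) [Field F] (n : ℕ) : Submodule F (Gl F n) :=
  (traceZero F n).map (qMap F n)

/-- The group `T` of all operators that, for some nonzero scalars `α` and `β`, act as
multiplication by `α` on `M_n⁰` and by `β` on `F1`. -/
def torus (F : Type*) [Field F] (n : ℕ) : Set (Gl F n) :=
  {t | ∃ α β : F, α ≠ 0 ∧ β ≠ 0 ∧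
    (∀ x ∈ traceZero F n, t x = α • x) ∧ (∀ x ∈ scalars F n, t x = β • x)}

/-- The line `Ft`. -/
def line {F : Type*} [Field F] {n : ℕ} (t : Gl F n) : Submodule F (Gl F n) :=
  Submodule.span F {t}

/-- The linear subspace `A` of `gl(n²)` is a proper associative (not necessarily unital)
subalgebra that contains all inner derivations. -/
def IsProperSubalgebraOverInnerDer {F : Type*} [Field F] {n : ℕ}
    (A : Submodule F (Gl F n)) : Prop :=
  (∃ B : NonUnitalSubalgebra F (Gl F n), B.toSubmodule = A) ∧ A ≠ ⊤ ∧ innerDer F n ≤ A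

end InnerDerivations

/-
The operators that kill `1` and take values in `M_n⁰` form the corner `(1 - π) gl(n²) (1 - π)`,
where `π` is the projection onto `F1` along `M_n⁰`. A suitable product of inner derivations by
matrix units is, up to a scalar, a rank-one operator `x ↦ tr(xb)a` with `a` and `b` off-diagonal
matrix units. Multiplying it by inner derivations from either side moves `a` and `b` through all of
`M_n⁰`, since a Lie ideal of `M_n` that contains an off-diagonal matrix unit contains `M_n⁰`. Hence
a subalgebra contains all inner derivations if and only if it contains the corner.

Such a subalgebra contains `πf` and `fπ` along with `f`, hence is a sum of subspaces of the four
Peirce blocks of `π`. As `π` has rank one, each block is contained in the subalgebra or meets it in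
zero; as `gl(n²)` is prime, the product of the blocks `(i, j)` and `(j, k)` is nonzero. Subalgebras
over the corner therefore correspond to the transitive relations on `{0, 1}` that contain `(0, 0)`.
-/

namespace InnerDerivations

section Peirce

variable {R ι : Type*} [Ring R]

/-- Primeness of a ring, in the form `aRb ≠ 0` for all nonzero `a` and `b`. -/
def IsPrimeRing (R : Type*) [Ring R] : Prop :=
  ∀ a b : R, a ≠ 0 → b ≠ 0 → ∃ x, a * x * b ≠ 0

/-- The Peirce block `eᵢ R eⱼ` of a family `e` of idempotents. -/
def peirceBlock (K : Type*) [CommRing K] [Algebra K R] (e : ι → R) (i j : ι) : Submodule K R :=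
  LinearMap.range (LinearMap.mulLeftRight K (e i, e j))

/-- The sum of the Peirce blocks `eᵢ R eⱼ` over the pairs `(i, j)` of a finite relation. -/
def peirceSum (K : Type*) [CommRing K] [Algebra K R] (e : ι → R) (r : Finset (ι × ι)) :
    Submodule K R :=
  r.sup fun p => peirceBlock K e p.1 p.2

/-- Transitivity of a relation given by the finite set of its pairs, which makes it decidable. -/
abbrev IsTransitive (r : Finset (ι × ι)) : Prop :=
  ∀ i j k, (i, j) ∈ r → (j, k) ∈ r → (i, k) ∈ r

variable {K : Type*} [CommRing K] [Algebra K R] {e : ι → R}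

theorem mul_mul_mem_peirceBlock (i j : ι) (x : R) : e i * x * e j ∈ peirceBlock K e i j :=
  ⟨x, rfl⟩

theorem mem_peirceBlock_iff (he : OrthogonalIdempotents e) {i j : ι} {x : R} :
    x ∈ peirceBlock K e i j ↔ e i * x * e j = x := by
  refine ⟨?_, fun h => ⟨x, h⟩⟩
  rintro ⟨y, rfl⟩
  simp only [LinearMap.mulLeftRight_apply, mul_assoc, (he.idem j).eq]
  simp only [← mul_assoc, (he.idem i).eq]

theorem mem_peirceBlock_iff_mul_eq_self (he : OrthogonalIdempotents e) {i j : ι} {x : R} :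
    x ∈ peirceBlock K e i j ↔ e i * x = x ∧ x * e j = x := by
  rw [mem_peirceBlock_iff he]
  refine ⟨fun hx => ?_, fun ⟨hi, hj⟩ => by rw [hi, hj]⟩
  rw [← hx]
  exact ⟨by simp only [← mul_assoc, (he.idem i).eq], by rw [mul_assoc, (he.idem j).eq]⟩

theorem IsPrimeRing.exists_mem_peirceBlock_ne_zero (hR : IsPrimeRing R)
    (he : ∀ i, e i ≠ 0) (i j : ι) : ∃ x ∈ peirceBlock K e i j, x ≠ 0 :=
  let ⟨x, hx⟩ := hR _ _ (he i) (he j)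
  ⟨_, mul_mul_mem_peirceBlock i j x, hx⟩

variable [Fintype ι]

theorem sum_sum_mul_mul (he : CompleteOrthogonalIdempotents e) (x : R) :
    ∑ i, ∑ j, e i * x * e j = x := by
  simp only [← Finset.mul_sum, ← Finset.sum_mul, he.complete, one_mul, mul_one]

theorem mem_peirceSum_iff (he : CompleteOrthogonalIdempotents e) {r : Finset (ι × ι)} {x : R} :
    x ∈ peirceSum K e r ↔ ∀ i j, (i, j) ∉ r → e i * x * e j = 0 := by
  constructor
  · intro hx i j hij
    suffices peirceSum K e r ≤ LinearMap.ker (LinearMap.mulLeftRight K (e i, e j)) from this hx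
    refine Finset.sup_le fun p hp y hy => ?_
    rw [← (mem_peirceBlock_iff he.toOrthogonalIdempotents).1 hy, LinearMap.mem_ker,
      LinearMap.mulLeftRight_apply]
    by_cases hi : i = p.1
    · have hj : p.2 ≠ j := by
        rintro rfl
        exact hij (hi ▸ hp)
      rw [mul_assoc (e i), mul_assoc (e p.1 * y), he.ortho hj, mul_zero, mul_zero]
    · simp only [← mul_assoc, he.ortho hi, zero_mul]
  · intro h
    rw [← sum_sum_mul_mul he x]
    refine Submodule.sum_mem _ fun i _ => Submodule.sum_mem _ fun j _ => ?_
    by_cases hij : (i, j) ∈ r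
    · exact Finset.le_sup (f := fun p : ι × ι => peirceBlock K e p.1 p.2) hij
        (mul_mul_mem_peirceBlock i j x)
    · rw [h i j hij]
      exact zero_mem _

theorem peirceSum_univ (he : CompleteOrthogonalIdempotents e) :
    peirceSum K e Finset.univ = ⊤ :=
  eq_top_iff.2 fun _ _ => (mem_peirceSum_iff he).2 fun i j hij =>
    absurd (Finset.mem_univ (i, j)) hij

theorem mul_mem_peirceSum (he : CompleteOrthogonalIdempotents e) {r : Finset (ι × ι)}
    (hr : IsTransitive r) {x y : R} (hx : x ∈ peirceSum K e r) (hy : y ∈ peirceSum K e r) :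
    x * y ∈ peirceSum K e r := by
  rw [mem_peirceSum_iff he] at hx hy ⊢
  intro i k hik
  have insert_one : e i * (x * y) * e k = ∑ j, e i * x * e j * (e j * y * e k) := by
    calc e i * (x * y) * e k = e i * x * (∑ j, e j) * (y * e k) := by
          rw [he.complete, mul_one]
          simp only [mul_assoc]
      _ = ∑ j, e i * x * e j * (e j * y * e k) := by
          rw [Finset.mul_sum, Finset.sum_mul]
          refine Finset.sum_congr rfl fun j _ => ?_
          simp only [mul_assoc]
          rw [← mul_assoc (e j) (e j), (he.idem j).eq]
  rw [insert_one]
  refine Finset.sum_eq_zero fun j _ => ?_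
  by_cases hij : (i, j) ∈ r
  · rw [hy j k fun hjk => hik (hr i j k hij hjk), mul_zero]
  · rw [hx i j hij, zero_mul]

theorem peirceBlock_le_peirceSum_iff (hR : IsPrimeRing R) (he : CompleteOrthogonalIdempotents e)
    (he0 : ∀ i, e i ≠ 0) {r : Finset (ι × ι)} {i j : ι} :
    peirceBlock K e i j ≤ peirceSum K e r ↔ (i, j) ∈ r := by
  refine ⟨fun h => ?_, Finset.le_sup (f := fun p : ι × ι => peirceBlock K e p.1 p.2)⟩
  obtain ⟨x, hx, hx0⟩ := hR.exists_mem_peirceBlock_ne_zero (K := K) he0 i j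
  by_contra hij
  rw [← (mem_peirceBlock_iff he.toOrthogonalIdempotents).1 hx] at hx0
  exact hx0 ((mem_peirceSum_iff he).1 (h hx) i j hij)

theorem peirceSum_injective (hR : IsPrimeRing R) (he : CompleteOrthogonalIdempotents e)
    (he0 : ∀ i, e i ≠ 0) : Function.Injective (peirceSum K e) := by
  intro r s h
  ext ⟨i, j⟩
  rw [← peirceBlock_le_peirceSum_iff (K := K) hR he he0, h, peirceBlock_le_peirceSum_iff hR he he0]

theorem exists_isTransitive_eq_peirceSum (hR : IsPrimeRing R)
    (he : CompleteOrthogonalIdempotents e) (he0 : ∀ i, e i ≠ 0) {A : NonUnitalSubalgebra K R}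
    (hA : ∀ i j, ∀ x ∈ A, e i * x * e j ∈ A)
    (hblock : ∀ i j, ∀ x ∈ A, x ∈ peirceBlock K e i j → x ≠ 0 →
      peirceBlock K e i j ≤ A.toSubmodule) :
    ∃ r, IsTransitive r ∧ A.toSubmodule = peirceSum K e r := by
  classical
  refine ⟨Finset.univ.filter fun p => peirceBlock K e p.1 p.2 ≤ A.toSubmodule, ?_, ?_⟩
  · intro i j k hij hjk
    simp only [Finset.mem_filter, Finset.mem_univ, true_and] at hij hjk ⊢
    obtain ⟨a, ha, ha0⟩ := hR.exists_mem_peirceBlock_ne_zero (K := K) he0 i j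
    obtain ⟨x, hx⟩ := hR a (e k) ha0 (he0 k)
    obtain ⟨hia, haj⟩ := (mem_peirceBlock_iff_mul_eq_self he.toOrthogonalIdempotents).1 ha
    have hprod : a * (e j * x * e k) = a * x * e k := by
      simp only [← mul_assoc, haj]
    refine hblock i k (a * x * e k) ?_ ⟨a * x, ?_⟩ hx
    · exact hprod ▸ A.mul_mem (hij ha) (hjk (mul_mul_mem_peirceBlock j k x))
    · rw [LinearMap.mulLeftRight_apply, ← mul_assoc, hia]
  · refine le_antisymm (fun x hx => (mem_peirceSum_iff he).2 fun i j hij => ?_)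
      (Finset.sup_le fun p hp => (Finset.mem_filter.1 hp).2)
    by_contra hne
    exact hij (Finset.mem_filter.2 ⟨Finset.mem_univ _,
      hblock i j _ (hA i j x hx) (mul_mul_mem_peirceBlock i j x) hne⟩)

end Peirce

section MinimalIdempotent

variable {F R ι : Type*} [Field F] [Ring R] [Algebra F R] {e : ι → R} {i j : ι} {f g : R}

theorem exists_corner_mul_eq (hR : IsPrimeRing R) (he : OrthogonalIdempotents e)
    (hj : ∀ x, ∃ c : F, e j * x * e j = c • e j) (hf : f ∈ peirceBlock F e i j) (hf0 : f ≠ 0)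
    (hg : g ∈ peirceBlock F e i j) : ∃ h ∈ peirceBlock F e i i, h * f = g := by
  obtain ⟨hif, hfj⟩ := (mem_peirceBlock_iff_mul_eq_self he).1 hf
  obtain ⟨hig, hgj⟩ := (mem_peirceBlock_iff_mul_eq_self he).1 hg
  obtain ⟨x, hx⟩ := hR (e j) f (fun h => hf0 (by rw [← hfj, h, mul_zero])) hf0
  obtain ⟨c, hc⟩ := hj (x * f)
  have hxf : e j * x * f = c • e j := by rw [← hc, mul_assoc, mul_assoc, mul_assoc, hfj]
  have hc0 : c ≠ 0 := by
    rintro rfl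
    exact hx (hxf.trans (zero_smul F _))
  refine ⟨_, mul_mul_mem_peirceBlock i i (c⁻¹ • (g * x)), ?_⟩
  calc e i * (c⁻¹ • (g * x)) * e i * f = c⁻¹ • (g * (e j * x * f)) := by
        rw [mul_assoc _ (e i), hif, mul_smul_comm, smul_mul_assoc, ← mul_assoc (e i), hig,
          ← mul_assoc, ← mul_assoc, hgj]
    _ = g := by rw [hxf, mul_smul_comm, hgj, inv_smul_smul₀ hc0]

theorem exists_mul_corner_eq (hR : IsPrimeRing R) (he : OrthogonalIdempotents e)
    (hi : ∀ x, ∃ c : F, e i * x * e i = c • e i) (hf : f ∈ peirceBlock F e i j) (hf0 : f ≠ 0)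
    (hg : g ∈ peirceBlock F e i j) : ∃ h ∈ peirceBlock F e j j, f * h = g := by
  obtain ⟨hif, hfj⟩ := (mem_peirceBlock_iff_mul_eq_self he).1 hf
  obtain ⟨hig, hgj⟩ := (mem_peirceBlock_iff_mul_eq_self he).1 hg
  obtain ⟨x, hx⟩ := hR f (e i) hf0 (fun h => hf0 (by rw [← hif, h, zero_mul]))
  obtain ⟨c, hc⟩ := hi (f * x)
  have hfx : f * x * e i = c • e i := by rw [← hc, ← mul_assoc, hif]
  have hc0 : c ≠ 0 := by
    rintro rfl
    exact hx (hfx.trans (zero_smul F _))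
  refine ⟨_, mul_mul_mem_peirceBlock j j (c⁻¹ • (x * g)), ?_⟩
  calc f * (e j * (c⁻¹ • (x * g)) * e j) = c⁻¹ • (f * x * e i * g) := by
        rw [mul_smul_comm, smul_mul_assoc, mul_smul_comm, mul_assoc (e j), mul_assoc x, hgj,
          ← mul_assoc, hfj, mul_assoc _ (e i), hig, mul_assoc]
    _ = g := by rw [hfx, smul_mul_assoc, hig, inv_smul_smul₀ hc0]

theorem peirceBlock_self_le_of_mem {A : Submodule F R}
    (hi : ∀ x, ∃ c : F, e i * x * e i = c • e i) (hf : f ∈ peirceBlock F e i i) (hf0 : f ≠ 0)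
    (hfA : f ∈ A) : peirceBlock F e i i ≤ A := by
  obtain ⟨x, rfl⟩ := hf
  obtain ⟨c, hc⟩ := hi x
  rw [LinearMap.mulLeftRight_apply, hc] at hfA hf0
  have hmem : e i ∈ A := (A.smul_mem_iff (left_ne_zero_of_smul hf0)).1 hfA
  rintro _ ⟨y, rfl⟩
  obtain ⟨d, hd⟩ := hi y
  rw [LinearMap.mulLeftRight_apply, hd]
  exact A.smul_mem d hmem

end MinimalIdempotent

section PairOfIdempotents

variable {F R : Type*} [Field F] [Ring R] [Algebra F R] {e : Fin 2 → R}

theorem mul_mul_mem_of_corner_le (he : CompleteOrthogonalIdempotents e)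
    {A : NonUnitalSubalgebra F R} (hA : peirceBlock F e 0 0 ≤ A.toSubmodule) (i j : Fin 2) {x : R}
    (hx : x ∈ A) : e i * x * e j ∈ A := by
  have h0 : e 0 ∈ A := hA ((mem_peirceBlock_iff he.toOrthogonalIdempotents).2
    (by rw [(he.idem 0).eq, (he.idem 0).eq]))
  have h1 : e 1 = 1 - e 0 := by
    rw [← he.complete, Fin.sum_univ_two, add_sub_cancel_left]
  have left : ∀ i, ∀ y ∈ A, e i * y ∈ A := Fin.forall_fin_two.2
    ⟨fun y hy => A.mul_mem h0 hy, fun y hy => by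
      rw [h1, sub_mul, one_mul]
      exact sub_mem hy (A.mul_mem h0 hy)⟩
  have right : ∀ i, ∀ y ∈ A, y * e i ∈ A := Fin.forall_fin_two.2
    ⟨fun y hy => A.mul_mem hy h0, fun y hy => by
      rw [h1, mul_sub, mul_one]
      exact sub_mem hy (A.mul_mem hy h0)⟩
  exact right j _ (left i x hx)

theorem isSubalgebra_and_corner_le_iff (hR : IsPrimeRing R) (he : CompleteOrthogonalIdempotents e)
    (he0 : ∀ i, e i ≠ 0) (hmin : ∀ x, ∃ c : F, e 1 * x * e 1 = c • e 1) {A : Submodule F R} :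
    (∃ B : NonUnitalSubalgebra F R, B.toSubmodule = A) ∧ peirceBlock F e 0 0 ≤ A ↔
      ∃ r, (0, 0) ∈ r ∧ IsTransitive r ∧ peirceSum F e r = A := by
  constructor
  · rintro ⟨⟨B, rfl⟩, hB⟩
    have hblock : ∀ i j, ∀ f ∈ B, f ∈ peirceBlock F e i j → f ≠ 0 →
        peirceBlock F e i j ≤ B.toSubmodule := by
      simp only [Fin.forall_fin_two]
      refine ⟨⟨fun _ _ _ _ => hB, fun f hfB hf hf0 g hg => ?_⟩, fun f hfB hf hf0 g hg => ?_,
        fun f hfB hf hf0 => peirceBlock_self_le_of_mem hmin hf hf0 hfB⟩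
      · obtain ⟨h, hh, rfl⟩ := exists_corner_mul_eq hR he.toOrthogonalIdempotents hmin hf hf0 hg
        exact B.mul_mem (hB hh) hfB
      · obtain ⟨h, hh, rfl⟩ := exists_mul_corner_eq hR he.toOrthogonalIdempotents hmin hf hf0 hg
        exact B.mul_mem hfB (hB hh)
    obtain ⟨r, hr, h⟩ := exists_isTransitive_eq_peirceSum hR he he0
      (fun i j x => mul_mul_mem_of_corner_le he hB i j) hblock
    exact ⟨r, (peirceBlock_le_peirceSum_iff hR he he0).1 (h ▸ hB), hr, h.symm⟩
  · rintro ⟨r, h0, hr, rfl⟩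
    exact ⟨⟨{ peirceSum F e r with mul_mem' := mul_mem_peirceSum he hr }, rfl⟩,
      (peirceBlock_le_peirceSum_iff hR he he0).2 h0⟩

/-- The transitive relations on `{0, 1}` that contain `(0, 0)`, other than the full relation. -/
def properPatterns : Finset (Finset (Fin 2 × Fin 2)) :=
  {r | (0, 0) ∈ r ∧ IsTransitive r ∧ r ≠ Finset.univ}

theorem properPatterns_eq : properPatterns = {{(0, 0)}, {(0, 0), (0, 1)}, {(0, 0), (1, 0)},
    {(0, 0), (1, 1)}, {(0, 0), (0, 1), (1, 1)}, {(0, 0), (1, 0), (1, 1)}} := by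
  decide

end PairOfIdempotents

section InnerDerivation

variable {R ι : Type*} [CommRing R] [Fintype ι]

/-- The map sending `a` to the inner derivation `x ↦ ax - xa`. -/
def innerDerivation (R A : Type*) [CommRing R] [Ring A] [Algebra R A] : A →ₗ[R] Module.End R A :=
  LinearMap.mul R A - (LinearMap.mul R A).flip

theorem innerDerivation_apply {A : Type*} [Ring A] [Algebra R A] (a x : A) :
    innerDerivation R A a x = a * x - x * a := rfl

theorem innerDerivation_innerDerivation_apply {A : Type*} [Ring A] [Algebra R A] {a b : A}
    (hab : a * b = 0) (hba : b * a = 0) (x : A) :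
    innerDerivation R A a (innerDerivation R A b x) = -(a * x * b + b * x * a) := by
  simp only [innerDerivation_apply, mul_sub, sub_mul, ← mul_assoc, hab]
  simp only [mul_assoc, hba, zero_mul, mul_zero]
  abel

/-- The trace pairing as a map to the dual: `b` acts by `x ↦ tr(xb)`. -/
def traceDual (R ι : Type*) [CommRing R] [Fintype ι] :
    Matrix ι ι R →ₗ[R] Module.Dual R (Matrix ι ι R) :=
  (LinearMap.mul R (Matrix ι ι R)).flip.compr₂ (Matrix.traceLinearMap ι R R)

theorem traceDual_apply (b x : Matrix ι ι R) : traceDual R ι b x = (x * b).trace := rfl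

theorem traceDual_surjective : Function.Surjective (traceDual R ι) := by
  classical
  intro φ
  refine ⟨Matrix.of fun i j => φ (Matrix.single j i 1), ?_⟩
  ext1 x
  conv_rhs => rw [Matrix.matrix_eq_sum_single x]
  simp only [traceDual_apply, Matrix.trace, Matrix.diag_apply, Matrix.mul_apply, Matrix.of_apply,
    map_sum]
  refine Finset.sum_congr rfl fun i _ => Finset.sum_congr rfl fun j _ => ?_
  rw [← smul_eq_mul, ← map_smul, Matrix.smul_single, smul_eq_mul, mul_one]

/-- The operator `x ↦ tr(xb)a`, as a bilinear function of `a` and `b`. -/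
def rankOne (R ι : Type*) [CommRing R] [Fintype ι] :
    Matrix ι ι R →ₗ[R] Matrix ι ι R →ₗ[R] Module.End R (Matrix ι ι R) :=
  (LinearMap.smulRightₗ ∘ₗ traceDual R ι).flip

theorem rankOne_apply (a b x : Matrix ι ι R) : rankOne R ι a b x = (x * b).trace • a := rfl

variable [DecidableEq ι]

theorem innerDerivation_mul_rankOne (c a b : Matrix ι ι R) :
    innerDerivation R _ c * rankOne R ι a b = rankOne R ι (innerDerivation R _ c a) b := by
  ext1 x
  rw [Module.End.mul_apply, rankOne_apply, map_smul, rankOne_apply]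

theorem rankOne_mul_innerDerivation (a b c : Matrix ι ι R) :
    rankOne R ι a b * innerDerivation R _ c = -rankOne R ι a (innerDerivation R _ c b) := by
  ext1 x
  simp only [LinearMap.neg_apply, Module.End.mul_apply, rankOne_apply, innerDerivation_apply,
    ← neg_smul]
  congr 1
  rw [sub_mul, mul_sub, Matrix.trace_sub, Matrix.trace_sub, mul_assoc c x b,
    Matrix.trace_mul_comm c, mul_assoc x b c, mul_assoc x c b, neg_sub]

theorem sum_rankOne_single (f : Module.End R (Matrix ι ι R)) :
    ∑ k, ∑ l, rankOne R ι (f (Matrix.single k l 1)) (Matrix.single l k 1) = f := by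
  ext1 x
  conv_rhs => rw [Matrix.matrix_eq_sum_single x]
  simp only [LinearMap.sum_apply, rankOne_apply, Matrix.trace_mul_single, MulOpposite.op_one,
    one_smul, map_sum, ← map_smul, Matrix.smul_single, smul_eq_mul, mul_one]

theorem single_mul_mul_single_eq_rankOne (i j k l : ι) (x : Matrix ι ι R) :
    Matrix.single i j 1 * x * Matrix.single k l 1 =
      rankOne R ι (Matrix.single i l 1) (Matrix.single k j 1) x := by
  rw [Matrix.single_mul_mul_single, rankOne_apply, Matrix.trace_mul_single, MulOpposite.op_one,
    one_smul, Matrix.smul_single, one_mul, smul_eq_mul]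

theorem innerDerivation_single_mul_self {i j : ι} (hij : i ≠ j) :
    innerDerivation R (Matrix ι ι R) (Matrix.single i j 1) *
      innerDerivation R (Matrix ι ι R) (Matrix.single i j 1) =
      (-2 : R) • rankOne R ι (Matrix.single i j 1) (Matrix.single i j 1) := by
  have hsq : Matrix.single i j (1 : R) * Matrix.single i j 1 = 0 :=
    Matrix.single_mul_single_of_ne _ _ _ _ hij.symm _
  ext1 x
  rw [Module.End.mul_apply, innerDerivation_innerDerivation_apply hsq hsq,
    single_mul_mul_single_eq_rankOne, LinearMap.smul_apply]
  module

/-- Replaces the square of `ad eᵢⱼ` where `2` is not invertible. -/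
theorem innerDerivation_single_mul_mul {i j k : ι} (hij : i ≠ j) (hik : i ≠ k) (hjk : j ≠ k) :
    innerDerivation R (Matrix ι ι R) (Matrix.single k k 1) *
      (innerDerivation R (Matrix ι ι R) (Matrix.single i j 1) *
        innerDerivation R (Matrix ι ι R) (Matrix.single i k 1)) =
      rankOne R ι (Matrix.single i k 1) (Matrix.single i j 1) := by
  have hzero : ∀ {p q : ι}, i ≠ p → Matrix.single i p (1 : R) * Matrix.single i q 1 = 0 :=
    fun hp => Matrix.single_mul_single_of_ne _ _ _ _ hp.symm _
  ext1 x
  rw [Module.End.mul_apply, Module.End.mul_apply,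
    innerDerivation_innerDerivation_apply (hzero hij) (hzero hik),
    single_mul_mul_single_eq_rankOne, single_mul_mul_single_eq_rankOne]
  simp only [rankOne_apply, innerDerivation_apply, mul_neg, neg_mul, mul_add, add_mul,
    Matrix.mul_smul, Matrix.smul_mul, Matrix.single_mul_single_same,
    Matrix.single_mul_single_of_ne _ _ _ _ hik.symm, Matrix.single_mul_single_of_ne _ _ _ _ hjk]
  simp

end InnerDerivation

section LieIdeal

variable {R ι : Type*} [CommRing R] [Fintype ι] [DecidableEq ι]
  {L : Submodule R (Matrix ι ι R)} {i j : ι}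

theorem ker_trace_le_of_forall_mem [Nonempty ι]
    (hoff : ∀ k l, k ≠ l → Matrix.single k l (1 : R) ∈ L)
    (hdiag : ∀ k l, Matrix.single k k (1 : R) - Matrix.single l l 1 ∈ L) :
    LinearMap.ker (Matrix.traceLinearMap ι R R) ≤ L := by
  intro x hx
  obtain ⟨i⟩ := ‹Nonempty ι›
  have hsum : x = ∑ k, ∑ l, x k l •
      (Matrix.single k l (1 : R) - if k = l then Matrix.single i i 1 else 0) := by
    have htrace : ∑ k, x k k = 0 := hx
    simp only [smul_sub, smul_ite, smul_zero, Finset.sum_sub_distrib, Finset.sum_ite_eq,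
      Finset.mem_univ, if_true, ← Finset.sum_smul, htrace, zero_smul, sub_zero]
    conv_lhs => rw [Matrix.matrix_eq_sum_single x]
    simp only [Matrix.smul_single, smul_eq_mul, mul_one]
  rw [hsum]
  refine Submodule.sum_mem _ fun k _ => Submodule.sum_mem _ fun l _ => Submodule.smul_mem _ _ ?_
  split_ifs with hkl
  · subst hkl
    exact hdiag k i
  · rw [sub_zero]
    exact hoff k l hkl

variable (hL : ∀ c, ∀ x ∈ L, innerDerivation R (Matrix ι ι R) c x ∈ L)
include hL

theorem single_mem_of_col_eq {k : ι} (hkj : k ≠ j)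
    (h : Matrix.single i j (1 : R) ∈ L) : Matrix.single k j (1 : R) ∈ L := by
  have := hL (Matrix.single k i 1) _ h
  rwa [innerDerivation_apply, Matrix.single_mul_single_same,
    Matrix.single_mul_single_of_ne _ _ _ _ hkj.symm, sub_zero, mul_one] at this

theorem single_mem_of_row_eq {k : ι} (hik : i ≠ k)
    (h : Matrix.single i j (1 : R) ∈ L) : Matrix.single i k (1 : R) ∈ L := by
  have := hL (Matrix.single j k 1) _ h
  rwa [innerDerivation_apply, Matrix.single_mul_single_same,
    Matrix.single_mul_single_of_ne _ _ _ _ hik.symm, zero_sub, mul_one, neg_mem_iff] at this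

theorem single_sub_single_mem (h : Matrix.single i j (1 : R) ∈ L) :
    Matrix.single j j (1 : R) - Matrix.single i i 1 ∈ L := by
  have := hL (Matrix.single j i 1) _ h
  rwa [innerDerivation_apply, Matrix.single_mul_single_same, Matrix.single_mul_single_same,
    mul_one] at this

theorem single_swap_mem (h2 : IsUnit (2 : R) ∨ 2 < Fintype.card ι) (hij : i ≠ j)
    (h : Matrix.single i j (1 : R) ∈ L) : Matrix.single j i (1 : R) ∈ L := by
  rcases h2 with h2 | hι
  · have hcomm := hL (Matrix.single j i 1) _ (single_sub_single_mem hL h)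
    rw [innerDerivation_apply, mul_sub, sub_mul, Matrix.single_mul_single_same,
      Matrix.single_mul_single_same, Matrix.single_mul_single_of_ne _ _ _ _ hij,
      Matrix.single_mul_single_of_ne _ _ _ _ hij, mul_one] at hcomm
    rw [← L.smul_mem_iff_of_isUnit h2.neg]
    convert hcomm using 1
    module
  · obtain ⟨k, hki, hkj⟩ : ∃ k, k ≠ i ∧ k ≠ j := by
      by_contra! hall
      exact hι.not_ge (Finset.card_le_two (a := i) (b := j) |>.trans' <|
        Finset.card_le_card fun k _ => by simpa using or_iff_not_imp_left.2 (hall k))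
    exact single_mem_of_row_eq hL hij.symm
      (single_mem_of_col_eq hL hkj.symm (single_mem_of_row_eq hL hki.symm h))

theorem single_mem_of_single_mem (h2 : IsUnit (2 : R) ∨ 2 < Fintype.card ι) (hij : i ≠ j)
    (h : Matrix.single i j (1 : R) ∈ L) {k l : ι} (hkl : k ≠ l) :
    Matrix.single k l (1 : R) ∈ L := by
  rcases eq_or_ne k j with rfl | hkj
  · exact single_mem_of_row_eq hL hkl (single_swap_mem hL h2 hij h)
  · exact single_mem_of_row_eq hL hkl (single_mem_of_col_eq hL hkj h)

theorem ker_trace_le_of_single_mem (h2 : IsUnit (2 : R) ∨ 2 < Fintype.card ι) (hij : i ≠ j)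
    (h : Matrix.single i j (1 : R) ∈ L) : LinearMap.ker (Matrix.traceLinearMap ι R R) ≤ L := by
  have : Nonempty ι := ⟨i⟩
  refine ker_trace_le_of_forall_mem (fun k l => single_mem_of_single_mem hL h2 hij h) fun k l => ?_
  rcases eq_or_ne k l with rfl | hkl
  · simp
  · exact single_sub_single_mem hL (single_mem_of_single_mem hL h2 hij h hkl.symm)

end LieIdeal

section Generation

variable {R ι : Type*} [CommRing R] [Fintype ι] [DecidableEq ι]
  {A : NonUnitalSubalgebra R (Module.End R (Matrix ι ι R))}

theorem exists_rankOne_single_mem [Nontrivial ι] (h2 : IsUnit (2 : R) ∨ 2 < Fintype.card ι)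
    (hA : ∀ c, innerDerivation R (Matrix ι ι R) c ∈ A) :
    ∃ i j k l, i ≠ j ∧ k ≠ l ∧ rankOne R ι (Matrix.single i j 1) (Matrix.single k l 1) ∈ A := by
  rcases h2 with h2 | hι
  · obtain ⟨i, j, hij⟩ := exists_pair_ne ι
    have h := A.mul_mem (hA (Matrix.single i j 1)) (hA (Matrix.single i j 1))
    rw [innerDerivation_single_mul_self hij] at h
    exact ⟨i, j, i, j, hij, hij, (A.toSubmodule.smul_mem_iff_of_isUnit h2.neg).1 h⟩
  · obtain ⟨i, j, k, hij, hik, hjk⟩ := Fintype.two_lt_card_iff.1 hι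
    refine ⟨i, k, i, j, hik, hij, ?_⟩
    rw [← innerDerivation_single_mul_mul hij hik hjk]
    exact A.mul_mem (hA _) (A.mul_mem (hA _) (hA _))

theorem rankOne_mem [Nontrivial ι] (h2 : IsUnit (2 : R) ∨ 2 < Fintype.card ι)
    (hA : ∀ c, innerDerivation R (Matrix ι ι R) c ∈ A) {a b : Matrix ι ι R}
    (ha : a.trace = 0) (hb : b.trace = 0) : rankOne R ι a b ∈ A := by
  obtain ⟨i, j, k, l, hij, hkl, hA1⟩ := exists_rankOne_single_mem h2 hA
  have left : LinearMap.ker (Matrix.traceLinearMap ι R R) ≤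
      A.toSubmodule.comap ((rankOne R ι).flip (Matrix.single k l 1)) := by
    refine ker_trace_le_of_single_mem (fun c x hx => ?_) h2 hij hA1
    rw [Submodule.mem_comap, LinearMap.flip_apply] at hx ⊢
    rw [← innerDerivation_mul_rankOne]
    exact A.mul_mem (hA c) hx
  have hakl : rankOne R ι a (Matrix.single k l 1) ∈ A.toSubmodule := left (x := a) ha
  have right : LinearMap.ker (Matrix.traceLinearMap ι R R) ≤
      A.toSubmodule.comap (rankOne R ι a) := by
    refine ker_trace_le_of_single_mem (fun c x hx => ?_) h2 hkl hakl
    rw [Submodule.mem_comap] at hx ⊢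
    rw [← neg_mem_iff, ← rankOne_mul_innerDerivation]
    exact A.mul_mem hx (hA c)
  exact right (x := b) hb

theorem mem_of_map_one_eq_zero [Nontrivial ι] (h2 : IsUnit (2 : R) ∨ 2 < Fintype.card ι)
    (hcard : IsUnit (Fintype.card ι : R)) (hA : ∀ c, innerDerivation R (Matrix ι ι R) c ∈ A)
    {f : Module.End R (Matrix ι ι R)} (hf : ∀ x, (f x).trace = 0) (hf1 : f 1 = 0) : f ∈ A := by
  obtain ⟨d, hd⟩ := hcard.exists_right_inv
  have hscalar : ∑ k, ∑ l, rankOne R ι (f (Matrix.single k l 1))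
      (((Matrix.single l k (1 : R)).trace * d) • 1) = 0 := by
    have hcollapse : ∀ k, ∑ l, rankOne R ι (f (Matrix.single k l 1))
        (((Matrix.single l k (1 : R)).trace * d) • 1) =
          rankOne R ι (f (Matrix.single k k 1)) (d • 1) := fun k => by
      rw [Finset.sum_eq_single k, Matrix.trace_single_eq_same, one_mul]
      · intro l _ hl
        rw [Matrix.trace_single_eq_of_ne _ _ _ hl, zero_mul, zero_smul, map_zero]
      · exact fun hk => absurd (Finset.mem_univ k) hk
    rw [Finset.sum_congr rfl fun k _ => hcollapse k, ← LinearMap.sum_apply, ← map_sum, ← map_sum,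
      Matrix.sum_single_one, hf1, map_zero, LinearMap.zero_apply]
  have hsum : f = ∑ k, ∑ l, rankOne R ι (f (Matrix.single k l 1))
      (Matrix.single l k 1 - ((Matrix.single l k (1 : R)).trace * d) • 1) := by
    simp only [map_sub, Finset.sum_sub_distrib, hscalar, sum_rankOne_single, sub_zero]
  rw [hsum]
  refine sum_mem fun k _ => sum_mem fun l _ => rankOne_mem h2 hA (hf _) ?_
  rw [Matrix.trace_sub, Matrix.trace_smul, Matrix.trace_one, smul_eq_mul, mul_assoc, mul_comm d,
    hd, mul_one, sub_self]

end Generation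

section TraceDecomposition

variable {F : Type*} [Field F] {n : ℕ}

theorem isPrimeRing_end {V : Type*} [AddCommGroup V] [Module F V] :
    IsPrimeRing (Module.End F V) := by
  intro a b ha hb
  obtain ⟨y, hy⟩ := DFunLike.ne_iff.1 hb
  obtain ⟨z, hz⟩ := DFunLike.ne_iff.1 ha
  obtain ⟨φ, hφ⟩ := Module.Projective.exists_dual_ne_zero F hy
  refine ⟨φ.smulRight z, fun h => smul_ne_zero hφ hz ?_⟩
  have := LinearMap.congr_fun h y
  rwa [Module.End.mul_apply, Module.End.mul_apply, LinearMap.smulRight_apply, map_smul] at this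

/-- The projection of `M_n` onto `F1` along `M_n⁰`, for `n` invertible in `F`. -/
def scalarProj (F : Type*) [Field F] (n : ℕ) : Gl F n :=
  (n : F)⁻¹ • pMap F n 1

/-- The projections of `M_n` onto `M_n⁰` and onto `F1`, indexed by `0` and `1`, for `n` invertible
in `F`. -/
def traceIdempotents (F : Type*) [Field F] (n : ℕ) : Fin 2 → Gl F n :=
  ![1 - scalarProj F n, scalarProj F n]

theorem mem_traceZero {x : Mat F n} : x ∈ traceZero F n ↔ x.trace = 0 :=
  Iff.rfl

theorem mem_scalars {x : Mat F n} : x ∈ scalars F n ↔ ∃ c : F, c • (1 : Mat F n) = x :=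
  Submodule.mem_span_singleton

theorem pMap_apply (a x : Mat F n) : pMap F n a x = x.trace • a :=
  rfl

theorem qMap_apply (a x : Mat F n) : qMap F n a x = (x * a).trace • (1 : Mat F n) :=
  rfl

theorem scalarProj_apply (x : Mat F n) :
    scalarProj F n x = ((n : F)⁻¹ * x.trace) • (1 : Mat F n) :=
  smul_smul _ x.trace 1

variable (hnF : (n : F) ≠ 0)
include hnF

theorem scalarProj_one : scalarProj F n 1 = 1 := by
  rw [scalarProj_apply, Matrix.trace_one, Fintype.card_fin, inv_mul_cancel₀ hnF, one_smul]

theorem trace_scalarProj (x : Mat F n) : (scalarProj F n x).trace = x.trace := by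
  rw [scalarProj_apply, Matrix.trace_smul, Matrix.trace_one, Fintype.card_fin, smul_eq_mul,
    mul_right_comm, inv_mul_cancel₀ hnF, one_mul]

theorem isIdempotentElem_scalarProj : IsIdempotentElem (scalarProj F n) := by
  ext1 x
  rw [Module.End.mul_apply, scalarProj_apply x, map_smul, scalarProj_one hnF]

theorem completeOrthogonalIdempotents_traceIdempotents :
    CompleteOrthogonalIdempotents (traceIdempotents F n) := by
  have h := CompleteOrthogonalIdempotents.of_isIdempotentElem
    (isIdempotentElem_scalarProj hnF).one_sub
  rwa [sub_sub_cancel] at h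

theorem orthogonalIdempotents_traceIdempotents : OrthogonalIdempotents (traceIdempotents F n) :=
  (completeOrthogonalIdempotents_traceIdempotents hnF).toOrthogonalIdempotents

theorem traceIdempotents_ne_zero (hn : 2 ≤ n) : ∀ i, traceIdempotents F n i ≠ 0 := by
  have : Nontrivial (Fin n) := Fin.nontrivial_iff_two_le.2 hn
  obtain ⟨i, j, hij⟩ := exists_pair_ne (Fin n)
  refine Fin.forall_fin_two.2 ⟨fun h => ?_, fun h => ?_⟩
  · have happly : traceIdempotents F n 0 (Matrix.single i j 1) = Matrix.single i j 1 := by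
      change Matrix.single i j 1 - scalarProj F n (Matrix.single i j 1) = _
      rw [scalarProj_apply, Matrix.trace_single_eq_of_ne _ _ _ hij, mul_zero, zero_smul, sub_zero]
    rw [h, LinearMap.zero_apply] at happly
    exact one_ne_zero (congrFun₂ happly i j ▸ Matrix.single_apply_same i j (1 : F)).symm
  · have happly : traceIdempotents F n 1 1 = 1 := scalarProj_one hnF
    rw [h, LinearMap.zero_apply] at happly
    exact one_ne_zero (congrFun₂ happly i i ▸ Matrix.one_apply_eq i).symm

theorem traceIdempotents_zero_mul_eq_self_iff {f : Gl F n} :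
    traceIdempotents F n 0 * f = f ↔ ∀ x, (f x).trace = 0 := by
  have hsub : traceIdempotents F n 0 * f = f - scalarProj F n * f := one_sub_mul _ _
  rw [hsub, sub_eq_self]
  refine ⟨fun h x => ?_, fun h => LinearMap.ext fun x => ?_⟩
  · rw [← trace_scalarProj hnF, ← Module.End.mul_apply, h, LinearMap.zero_apply, Matrix.trace_zero]
  · rw [Module.End.mul_apply, scalarProj_apply, h, mul_zero, zero_smul, LinearMap.zero_apply]

theorem mul_traceIdempotents_zero_eq_self_iff {f : Gl F n} :
    f * traceIdempotents F n 0 = f ↔ f 1 = 0 := by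
  have hsub : f * traceIdempotents F n 0 = f - f * scalarProj F n := mul_one_sub _ _
  rw [hsub, sub_eq_self]
  refine ⟨fun h => ?_, fun h => LinearMap.ext fun x => ?_⟩
  · rw [← scalarProj_one hnF, ← Module.End.mul_apply, h, LinearMap.zero_apply]
  · rw [Module.End.mul_apply, scalarProj_apply, map_smul, h, smul_zero, LinearMap.zero_apply]

omit hnF in
theorem traceIdempotents_one_mul_mul (f : Gl F n) :
    traceIdempotents F n 1 * f * traceIdempotents F n 1 =
      ((n : F)⁻¹ * (f 1).trace) • traceIdempotents F n 1 := by
  change scalarProj F n * f * scalarProj F n = _ • scalarProj F n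
  ext1 x
  simp only [Module.End.mul_apply, LinearMap.smul_apply, scalarProj_apply x, map_smul,
    scalarProj_apply (f 1), smul_comm ((n : F)⁻¹ * x.trace)]

theorem mem_glSub {f : Gl F n} : f ∈ glSub F n ↔ (∀ x, (f x).trace = 0) ∧ f 1 = 0 := by
  refine ⟨fun ⟨h0, _, h1⟩ => ⟨fun x => ?_, h1⟩,
    fun ⟨h0, h1⟩ => ⟨fun x _ => h0 x, fun x hx => ?_, h1⟩⟩
  · have hx : (x - scalarProj F n x).trace = 0 := by
      rw [Matrix.trace_sub, trace_scalarProj hnF, sub_self]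
    have hfx := h0 _ hx
    rwa [map_sub, scalarProj_apply, map_smul, h1, smul_zero, sub_zero] at hfx
  · obtain ⟨c, rfl⟩ := mem_scalars.1 hx
    rw [map_smul, h1, smul_zero]
    exact zero_mem _

theorem peirceBlock_zero_zero : peirceBlock F (traceIdempotents F n) 0 0 = glSub F n := by
  ext f
  rw [mem_peirceBlock_iff_mul_eq_self (orthogonalIdempotents_traceIdempotents hnF),
    traceIdempotents_zero_mul_eq_self_iff hnF, mul_traceIdempotents_zero_eq_self_iff hnF,
    mem_glSub hnF]

theorem peirceBlock_zero_one : peirceBlock F (traceIdempotents F n) 0 1 = pSpace F n := by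
  ext f
  rw [mem_peirceBlock_iff_mul_eq_self (orthogonalIdempotents_traceIdempotents hnF),
    traceIdempotents_zero_mul_eq_self_iff hnF]
  constructor
  · rintro ⟨htrace, hf⟩
    refine ⟨(n : F)⁻¹ • f 1, ?_, LinearMap.ext fun x => ?_⟩
    · rw [SetLike.mem_coe, mem_traceZero, Matrix.trace_smul, htrace, smul_zero]
    · calc pMap F n ((n : F)⁻¹ • f 1) x = f (scalarProj F n x) := by
            rw [pMap_apply, scalarProj_apply, map_smul, smul_smul, mul_comm]
        _ = f x := LinearMap.congr_fun hf x
  · rintro ⟨a, ha, rfl⟩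
    refine ⟨fun x => ?_, LinearMap.ext fun x => ?_⟩
    · rw [pMap_apply, Matrix.trace_smul, mem_traceZero.1 ha, smul_zero]
    · exact congrArg (· • a) (trace_scalarProj hnF x)

theorem peirceBlock_one_zero : peirceBlock F (traceIdempotents F n) 1 0 = qSpace F n := by
  ext f
  rw [mem_peirceBlock_iff_mul_eq_self (orthogonalIdempotents_traceIdempotents hnF),
    mul_traceIdempotents_zero_eq_self_iff hnF]
  constructor
  · rintro ⟨hf, hf1⟩
    have hfx : ∀ x, ((n : F)⁻¹ * (f x).trace) • 1 = f x := fun x => by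
      rw [← scalarProj_apply, ← Module.End.mul_apply]
      exact LinearMap.congr_fun hf x
    obtain ⟨b, hb⟩ := traceDual_surjective ((n : F)⁻¹ • Matrix.traceLinearMap (Fin n) F F ∘ₗ f)
    have hxb : ∀ x, (x * b).trace = (n : F)⁻¹ * (f x).trace := LinearMap.congr_fun hb
    refine ⟨b, ?_, LinearMap.ext fun x => ?_⟩
    · rw [SetLike.mem_coe, mem_traceZero, ← one_mul b, hxb, hf1, Matrix.trace_zero, mul_zero]
    · rw [qMap_apply, hxb, hfx]
  · rintro ⟨b, hb, rfl⟩
    refine ⟨LinearMap.ext fun x => ?_, ?_⟩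
    · exact (map_smul _ _ _).trans (congrArg _ (scalarProj_one hnF))
    · rw [qMap_apply, one_mul, mem_traceZero.1 hb, zero_smul]

theorem eq_smul_add_smul_of_mem_torus {t : Gl F n} (ht : t ∈ torus F n) :
    ∃ α β : F, β ≠ 0 ∧ t = α • traceIdempotents F n 0 + β • traceIdempotents F n 1 := by
  obtain ⟨α, β, -, hβ, h0, h1⟩ := ht
  refine ⟨α, β, hβ, LinearMap.ext fun x => ?_⟩
  have htrace : (x - scalarProj F n x).trace = 0 := by
    rw [Matrix.trace_sub, trace_scalarProj hnF, sub_self]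
  calc t x = t (x - scalarProj F n x) + t (scalarProj F n x) := by
        rw [← map_add, sub_add_cancel]
    _ = α • (x - scalarProj F n x) + β • scalarProj F n x := by
        rw [h0 _ htrace, h1 _ (mem_scalars.2 ⟨_, (scalarProj_apply x).symm⟩)]

theorem glSub_sup_line {t : Gl F n} (ht : t ∈ torus F n) :
    glSub F n ⊔ line t = glSub F n ⊔ peirceBlock F (traceIdempotents F n) 1 1 := by
  obtain ⟨α, β, hβ, rfl⟩ := eq_smul_add_smul_of_mem_torus hnF ht
  set e := traceIdempotents F n
  have he : ∀ i, e i ∈ peirceBlock F e i i := fun i =>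
    (mem_peirceBlock_iff_mul_eq_self (orthogonalIdempotents_traceIdempotents hnF)).2
      ⟨(completeOrthogonalIdempotents_traceIdempotents hnF).idem i,
        (completeOrthogonalIdempotents_traceIdempotents hnF).idem i⟩
  have he0 : e 0 ∈ glSub F n := peirceBlock_zero_zero hnF ▸ he 0
  refine le_antisymm (sup_le le_sup_left ?_) (sup_le le_sup_left ?_)
  · exact (Submodule.span_singleton_le_iff_mem _ _).2 (Submodule.add_mem_sup
      (Submodule.smul_mem _ α he0) (Submodule.smul_mem _ β (he 1)))
  · rintro _ ⟨f, rfl⟩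
    have he1 : α • e 0 + β • e 1 - α • e 0 ∈ glSub F n ⊔ line (α • e 0 + β • e 1) :=
      sub_mem (Submodule.mem_sup_right (Submodule.mem_span_singleton_self _))
        (Submodule.mem_sup_left (Submodule.smul_mem _ α he0))
    rw [add_sub_cancel_left, Submodule.smul_mem_iff _ hβ] at he1
    rw [LinearMap.mulLeftRight_apply, traceIdempotents_one_mul_mul]
    exact Submodule.smul_mem _ _ he1

omit hnF in
theorem one_mem_torus : (1 : Gl F n) ∈ torus F n :=
  ⟨1, 1, one_ne_zero, one_ne_zero, fun x _ => (one_smul F x).symm, fun x _ => (one_smul F x).symm⟩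

theorem exists_torus_glSub_sup_sup_line_iff {A B : Submodule F (Gl F n)} :
    (∃ t ∈ torus F n, A = glSub F n ⊔ B ⊔ line t) ↔
      A = glSub F n ⊔ B ⊔ peirceBlock F (traceIdempotents F n) 1 1 := by
  have absorb : ∀ t ∈ torus F n,
      glSub F n ⊔ B ⊔ line t = glSub F n ⊔ B ⊔ peirceBlock F (traceIdempotents F n) 1 1 :=
    fun t ht => by rw [sup_right_comm, glSub_sup_line hnF ht, sup_right_comm]
  exact ⟨fun ⟨t, ht, h⟩ => h.trans (absorb t ht),
    fun h => ⟨1, one_mem_torus, h.trans (absorb 1 one_mem_torus).symm⟩⟩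

theorem exists_torus_glSub_sup_line_iff {A : Submodule F (Gl F n)} :
    (∃ t ∈ torus F n, A = glSub F n ⊔ line t) ↔
      A = glSub F n ⊔ peirceBlock F (traceIdempotents F n) 1 1 := by
  simpa only [sup_bot_eq] using exists_torus_glSub_sup_sup_line_iff hnF (B := ⊥)

theorem innerDer_le_iff_glSub_le (hn : 2 ≤ n) {B : NonUnitalSubalgebra F (Gl F n)} :
    innerDer F n ≤ B.toSubmodule ↔ glSub F n ≤ B.toSubmodule := by
  constructor
  · intro h f hf
    have : Nontrivial (Fin n) := Fin.nontrivial_iff_two_le.2 hn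
    have h2 : IsUnit (2 : F) ∨ 2 < Fintype.card (Fin n) := by
      rw [isUnit_iff_ne_zero, Fintype.card_fin, or_iff_not_imp_left, not_not]
      intro h2
      refine lt_of_le_of_ne hn ?_
      rintro rfl
      exact hnF (by exact_mod_cast h2)
    obtain ⟨htrace, hone⟩ := (mem_glSub hnF).1 hf
    exact mem_of_map_one_eq_zero h2 (by rwa [Fintype.card_fin, isUnit_iff_ne_zero])
      (fun c => h ⟨c, rfl⟩) htrace hone
  · rintro h _ ⟨a, rfl⟩
    refine h ((mem_glSub hnF).2 ⟨fun x => ?_, ?_⟩)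
    · exact (Matrix.trace_sub _ _).trans (sub_eq_zero.2 (Matrix.trace_mul_comm a x))
    · exact sub_eq_zero.2 ((mul_one a).trans (one_mul a).symm)

theorem isProperSubalgebraOverInnerDer_iff_mem_image (hn : 2 ≤ n) {A : Submodule F (Gl F n)} :
    IsProperSubalgebraOverInnerDer A ↔
      A ∈ peirceSum F (traceIdempotents F n) '' properPatterns := by
  set e := traceIdempotents F n
  have he := completeOrthogonalIdempotents_traceIdempotents hnF
  have he0 := traceIdempotents_ne_zero hnF hn
  have hcorner : IsProperSubalgebraOverInnerDer A ↔
      A ≠ ⊤ ∧ (∃ B : NonUnitalSubalgebra F (Gl F n), B.toSubmodule = A) ∧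
        peirceBlock F e 0 0 ≤ A := by
    rw [peirceBlock_zero_zero hnF, IsProperSubalgebraOverInnerDer, and_left_comm]
    refine and_congr_right fun _ => and_congr_right ?_
    rintro ⟨B, rfl⟩
    exact innerDer_le_iff_glSub_le hnF hn
  have htop : ∀ r, peirceSum F e r ≠ ⊤ ↔ r ≠ Finset.univ := fun r => by
    rw [← peirceSum_univ (K := F) he, (peirceSum_injective isPrimeRing_end he he0).ne_iff]
  rw [hcorner, isSubalgebra_and_corner_le_iff isPrimeRing_end he he0
    fun f => ⟨_, traceIdempotents_one_mul_mul f⟩]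
  constructor
  · rintro ⟨hA, r, h0, hr, rfl⟩
    exact ⟨r, Finset.mem_filter.2 ⟨Finset.mem_univ r, h0, hr, (htop r).1 hA⟩, rfl⟩
  · rintro ⟨r, hmem, rfl⟩
    obtain ⟨-, h0, hr, hne⟩ := Finset.mem_filter.1 hmem
    exact ⟨(htop r).2 hne, r, h0, hr, rfl⟩

end TraceDecomposition

end InnerDerivations

open InnerDerivations in
theorem corollary2p6_general {F : Type*} [Field F] (n : ℕ) (hn : 2 ≤ n) (hnF : (n : F) ≠ 0) :
    (∀ A : Submodule F (Gl F n), IsProperSubalgebraOverInnerDer A ↔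
      A = glSub F n ∨
      A = glSub F n ⊔ pSpace F n ∨
      A = glSub F n ⊔ qSpace F n ∨
      (∃ t ∈ torus F n, A = glSub F n ⊔ line t) ∨
      (∃ t ∈ torus F n, A = glSub F n ⊔ pSpace F n ⊔ line t) ∨
      (∃ t ∈ torus F n, A = glSub F n ⊔ qSpace F n ⊔ line t)) ∧
    {A : Submodule F (Gl F n) | IsProperSubalgebraOverInnerDer A}.ncard = 6 := by
  have classification := fun A : Submodule F (Gl F n) =>
    isProperSubalgebraOverInnerDer_iff_mem_image hnF hn (A := A)
  refine ⟨fun A => ?_, ?_⟩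
  · rw [classification, properPatterns_eq, exists_torus_glSub_sup_line_iff hnF,
      exists_torus_glSub_sup_sup_line_iff hnF, exists_torus_glSub_sup_sup_line_iff hnF,
      ← peirceBlock_zero_zero hnF, ← peirceBlock_zero_one hnF, ← peirceBlock_one_zero hnF]
    simp only [peirceSum, Finset.coe_insert, Finset.coe_singleton, Set.image_insert_eq,
      Set.image_singleton, Set.mem_insert_iff, Set.mem_singleton_iff, Finset.sup_insert,
      Finset.sup_singleton, sup_assoc]
  · have hinj := peirceSum_injective (K := F) isPrimeRing_end
      (completeOrthogonalIdempotents_traceIdempotents hnF) (traceIdempotents_ne_zero hnF hn)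
    calc _ = (peirceSum F (traceIdempotents F n) '' properPatterns).ncard :=
          congrArg Set.ncard (Set.ext classification)
      _ = properPatterns.card := by
          rw [Set.ncard_image_of_injective _ hinj, Set.ncard_coe_finset]
      _ = 6 := by decide

theorem corollary2p6 {F : Type*} [Field F] [IsAlgClosed F] [CharZero F] (n : ℕ) (hn : 5 ≤ n) :
    (∀ A : Submodule F (InnerDerivations.Gl F n),
      InnerDerivations.IsProperSubalgebraOverInnerDer A ↔
        A = InnerDerivations.glSub F n ∨
        A = InnerDerivations.glSub F n ⊔ InnerDerivations.pSpace F n ∨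
        A = InnerDerivations.glSub F n ⊔ InnerDerivations.qSpace F n ∨
        (∃ t ∈ InnerDerivations.torus F n,
          A = InnerDerivations.glSub F n ⊔ InnerDerivations.line t) ∨
        (∃ t ∈ InnerDerivations.torus F n,
          A = InnerDerivations.glSub F n ⊔ InnerDerivations.pSpace F n ⊔
            InnerDerivations.line t) ∨
        (∃ t ∈ InnerDerivations.torus F n,
          A = InnerDerivations.glSub F n ⊔ InnerDerivations.qSpace F n ⊔
            InnerDerivations.line t)) ∧
    {A : Submodule F (InnerDerivations.Gl F n) |
      InnerDerivations.IsProperSubalgebraOverInnerDer A}.ncard = 6 :=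
  corollary2p6_general n (by omega) (Nat.cast_ne_zero.2 (by omega))
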